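/- Let $p$ be a prime and let $K$ be a field of characteristic $p$ that is complete with respect to a normalized discrete valuation $v_K : K^\times \twoheadrightarrow \mathbb{Z}$, with perfect residue field. Let $L/K$ be a finite Galois extension with group $G=\mathrm{Gal}(L/K)$, and let $v_L$ be the valuation of $L$ that extends $v_K$ up to equivalence, normalized so that $v_L(L^\times)=\mathbb{Z}$. For $\rho\in L$ write $K[G]\cdot\rho=\{\sum_{\sigma\in G}a_\sigma\sigma(\rho) : a_\sigma\in K\}$. Call $L/K$ fully ramified if its ramification index equals $[L:K]$, that is, if $v_L(\pi_K)=[L:K]$ for the prime elements $\pi_K$ of $K$. (1) Suppose that $L/K$ is fully ramified and $[L:K]=p^n$ for some integer $n\ge 0$. Let $\pi_L\in L$ be any prime element ($v_L(\pi_L)=1$), let $p(x)$ be its minimal polynomial over $K$ and $p'(x)$ the derivative of $p(x)$. Then: (a) every nonzero $\rho\in L$ with $v_L(\rho)\equiv -v_L(p'(\pi_L))-1 \pmod{[L:K]}$ generates a normal basis of $L/K$, i.e. $\{\sigma(\rho)\}_{\sigma\in G}$ is a $K$-basis of $L$, so that $K[G]\cdot\rho=L$; (b) for every integer $i\not\equiv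 -v_L(p'(\pi_L))-1 \pmod{[L:K]}$ there is a $\rho_i\in L$ with $v_L(\rho_i)=i$ and $K[G]\cdot\rho_i\subsetneq L$. (2) Suppose instead that $L/K$ is not a fully ramified extension of degree a power of $p$ (that is, $L/K$ is not fully ramified, or $[L:K]$ is not a power of $p$). Then for every $i\in\mathbb{Z}$ there is a $\rho_i\in L$ with $v_L(\rho_i)=i$ and $K[G]\cdot\rho_i\subsetneq L$. -/

import Mathlib

open scoped WithZero Valued

noncomputable section

/-- The additive valuation attached to a multiplicative valuation `w` with values in
`ℤᵐ⁰`: it sends `x ≠ 0` to the integer `i` with `w x = exp (-i)`.  (At `x = 0`, where the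
additive valuation is `∞`, the value is the default `0`; it is only used for `x ≠ 0`.) -/
def ord {F : Type*} [Field F] (w : Valuation F ℤᵐ⁰) (x : F) : ℤ :=
  -WithZero.log (w x)

/-- `L/K` is fully ramified with respect to the normalized discrete valuations `v` of `K`
and `w` of `L`: the ramification index, which is the `w`-order of a prime element of `K`,
equals the degree of `L/K`. -/
def IsFullyRamified {K L : Type*} [Field K] [Field L] [Algebra K L]
    (v : Valuation K ℤᵐ⁰) (w : Valuation L ℤᵐ⁰) : Prop :=
  ∀ ϖ : K, ord v ϖ = 1 → ord w (algebraMap K L ϖ) = (Module.finrank K L : ℤ)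

/-- `K[G] · ρ` for `G = Gal(L/K)`: the set of all `∑ σ ∈ G, a σ • σ ρ` with coefficients
`a σ ∈ K`, as a `K`-subspace of `L`. -/
def groupRingOrbit (K : Type*) {L : Type*} [Field K] [Field L] [Algebra K L] (ρ : L) :
    Submodule K L :=
  Submodule.span K (Set.range fun σ : Gal(L/K) => σ ρ)

/-- The conjugates of `ρ`, indexed by the Galois group, form a `K`-basis of `L`. -/
def GeneratesNormalBasis (K : Type*) {L : Type*} [Field K] [Field L] [Algebra K L]
    (ρ : L) : Prop :=
  ∃ b : Module.Basis Gal(L/K) K L, ∀ σ : Gal(L/K), b σ = σ ρ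

end

/-!
Two elementary facts about `ρ : L` govern the criterion. If `Tr ρ = 0`, or more generally if the
conjugates of `ρ` satisfy any nontrivial `K`-linear relation, then `K[G] · ρ ≠ L`. Conversely, if
`G` is a `p`-group and `Tr ρ ≠ 0`, then `K[G] · ρ = L`
(`groupRingOrbit_eq_top_of_trace_ne_zero`): otherwise the orthogonal complement of `K[G] · ρ` under
the trace form is a nonzero `G`-stable subspace, and a `p`-group acting on a nonzero space in
characteristic `p` has a nonzero fixed vector; this vector is a scalar `c` with `c * Tr ρ = 0`.

Let `L/K` be fully ramified of degree `N`, and let `π` be a prime element of `L` with minimal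
polynomial `f`. The elements `π ^ r / f'(π)` for `r < N` form a `K`-basis of `L` whose valuations
are pairwise incongruent modulo `N`, and by Euler's formula
(`trace_pow_div_aeval_derivative`) all of them have trace `0` except the one with `r = N - 1`,
which has trace `1`. The valuation of a combination of these elements is that of one of its terms,
so every element with valuation congruent to `-v(f'(π)) - 1` has nonzero trace
(`trace_ne_zero_of_ord`). For every other integer `i`, an element of valuation `i` can be corrected
by a `K`-multiple of an element in this critical class so that its trace vanishes while its
valuation stays the same (`exists_ord_eq_of_not_modEq`).

If `L/K` is not fully ramified, some unit `u` of `L` has a residue outside the residue field of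
`K`; otherwise approximation by `K`-combinations of the powers `π ^ j`, `j < e`, together with
completeness of `K`, would give `[L : K] = e` (`isFullyRamified_of_residue`). For `y` of
valuation `i`, the nonzero elements of the plane spanned by `y` and `u * y` have valuations in the
class of `i` modulo `e`, so a nonzero trace-zero element of the plane can be rescaled to have
valuation exactly `i` (`exists_trace_eq_zero_of_residue`).

If a prime `l ≠ p` divides `[L : K]`, take `g : Gal(L/K)` of order `l` and the sum
`T x = ∑ k < l, g ^ k x`. Since the Galois group preserves the valuation, `v (T x) ≥ v x`. If
equality holds, `T x` is an element of the same valuation fixed by `g`; if not, `x - T x / l` is an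
element of the same valuation killed by `T`. Either way its conjugates are dependent
(`exists_ord_eq_of_prime_dvd`).
-/

section ValuationCriterion

open WithZero

/-! ### Consequences of completeness -/

theorem exists_rankOne_of_surjective {F : Type*} [Field F] (v : Valuation F ℤᵐ⁰)
    (hv : Function.Surjective v) : Nonempty v.RankOne := by
  have : v.IsNontrivial := by
    obtain ⟨x, hx⟩ := hv (exp 1)
    exact ⟨x, by rw [hx]; simp, by rw [hx]; decide⟩
  have : MulArchimedean (MonoidWithZeroHom.ValueGroup₀ (.ofClass v)) :=
    MulArchimedean.comap (MonoidWithZeroHom.ValueGroup₀.embedding (f := (.ofClass v))).toMonoidHom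
      MonoidWithZeroHom.ValueGroup₀.embedding_strictMono
  exact Valuation.nonempty_rankOne_iff_mulArchimedean.2 this

section
variable {K : Type*} [Field K] [Valued K ℤᵐ⁰] {L : Type*} [Field L] [Algebra K L]

theorem continuous_algebraMap_of_hasExtension
    (hK : Function.Surjective (Valued.v : Valuation K ℤᵐ⁰))
    [Valued L ℤᵐ⁰] [(Valued.v : Valuation K ℤᵐ⁰).HasExtension (Valued.v : Valuation L ℤᵐ⁰)] :
    Continuous (algebraMap K L) := by
  refine continuous_of_continuousAt_zero (algebraMap K L) ?_
  intro s hs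
  rw [map_zero, Valued.mem_nhds_zero] at hs
  obtain ⟨γ, hγ⟩ := hs
  obtain ⟨ϖ, hϖ⟩ := hK (exp (-1))
  have hϖ0 : ϖ ≠ 0 := by
    rintro rfl
    rw [map_zero] at hϖ
    exact exp_ne_zero hϖ.symm
  have hlt : (Valued.v : Valuation L ℤᵐ⁰) (algebraMap K L ϖ) < 1 := by
    rw [Valuation.HasExtension.val_map_lt_one_iff (Valued.v : Valuation K ℤᵐ⁰), hϖ]; decide
  obtain ⟨n, hn⟩ := exists_pow_lt₀ hlt
    (Units.map (MonoidWithZeroHom.ValueGroup₀.embedding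
      (f := (.ofClass (Valued.v : Valuation L ℤᵐ⁰)))).toMonoidHom γ)
  rw [Filter.mem_map, Valued.mem_nhds_zero]
  refine ⟨Units.mk0 (Valued.v.restrict (ϖ ^ n)) (by simp [hϖ0]), fun x hx => hγ ?_⟩
  simp only [Units.val_mk0, Set.mem_ofPred_eq, Valuation.restrict_lt_iff] at hx
  rw [Set.mem_ofPred_eq, Valuation.restrict_lt_iff_lt_embedding]
  rw [← Valuation.HasExtension.val_map_lt_iff _ (Valued.v : Valuation L ℤᵐ⁰)] at hx
  refine hx.trans ?_
  simpa using hn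

variable [CompleteSpace K] [FiniteDimensional K L]

/-- Subspaces of `L` are closed for the topology of `w`, because `K` is complete and `L` is
finite-dimensional over `K`. -/
theorem mem_submodule_of_approx (hK : Function.Surjective (Valued.v : Valuation K ℤᵐ⁰))
    (w : Valuation L ℤᵐ⁰) [(Valued.v : Valuation K ℤᵐ⁰).HasExtension w]
    (S : Submodule K L) (x : L) (h : ∀ n : ℤ, ∃ s ∈ S, w (s - x) < exp n) : x ∈ S := by
  let : Valued L ℤᵐ⁰ := Valued.mk' w
  obtain ⟨_⟩ := exists_rankOne_of_surjective _ hK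
  have : (Valued.v : Valuation K ℤᵐ⁰).HasExtension (Valued.v : Valuation L ℤᵐ⁰) :=
    inferInstanceAs ((Valued.v : Valuation K ℤᵐ⁰).HasExtension w)
  have : ContinuousSMul K L :=
    continuousSMul_of_algebraMap K L (continuous_algebraMap_of_hasExtension hK)
  refine (Submodule.closed_of_finiteDimensional S).closure_subset_iff.2 subset_rfl ?_
  rw [mem_closure_iff_nhds]
  intro t ht
  obtain ⟨γ, hγ⟩ := Valued.mem_nhds.1 ht
  set c := MonoidWithZeroHom.ValueGroup₀.embedding
    (f := (.ofClass (Valued.v : Valuation L ℤᵐ⁰))) γ.1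
    with hc
  have hc0 : c ≠ 0 := by simp [hc]
  obtain ⟨s, hs, hsx⟩ := h (log c)
  rw [exp_log hc0] at hsx
  refine ⟨s, hγ ?_, hs⟩
  rw [Set.mem_ofPred_eq, Valuation.restrict_lt_iff_lt_embedding]
  exact hsx

/-- A `K`-algebra endomorphism `f` of `L` is continuous, as a linear map on a finite-dimensional
space over a complete field, and `w x < 1` means that `x` is topologically nilpotent. -/
theorem valuation_algHom_lt_one (hK : Function.Surjective (Valued.v : Valuation K ℤᵐ⁰))
    (w : Valuation L ℤᵐ⁰) [(Valued.v : Valuation K ℤᵐ⁰).HasExtension w]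
    (f : L →ₐ[K] L) (x : L) (hx : w x < 1) : w (f x) < 1 := by
  let : Valued L ℤᵐ⁰ := Valued.mk' w
  obtain ⟨_⟩ := exists_rankOne_of_surjective _ hK
  have : (Valued.v : Valuation K ℤᵐ⁰).HasExtension (Valued.v : Valuation L ℤᵐ⁰) :=
    inferInstanceAs ((Valued.v : Valuation K ℤᵐ⁰).HasExtension w)
  have : ContinuousSMul K L :=
    continuousSMul_of_algebraMap K L (continuous_algebraMap_of_hasExtension hK)
  have hf : Continuous f := LinearMap.continuous_of_finiteDimensional f.toLinearMap
  have h0 := hf.tendsto 0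
  have hmem : {y : L | Valued.v.restrict y < 1} ∈ nhds (f 0) := by
    rw [map_zero]; exact Valued.mem_nhds_zero.2 ⟨1, by simp⟩
  obtain ⟨γ, hγ⟩ := Valued.mem_nhds_zero.1 (h0 hmem)
  obtain ⟨n, hn⟩ := exists_pow_lt₀ hx
    (Units.map (MonoidWithZeroHom.ValueGroup₀.embedding
      (f := (.ofClass (Valued.v : Valuation L ℤᵐ⁰)))).toMonoidHom γ)
  have : x ^ n ∈ {y : L | Valued.v.restrict y < γ.1} := by
    rw [Set.mem_ofPred_eq, Valuation.restrict_lt_iff_lt_embedding]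
    change w (x ^ n) < _
    rw [map_pow]
    exact hn
  have h1 := hγ this
  simp only [Set.mem_preimage, Set.mem_ofPred_eq, Valuation.restrict_lt_one_iff, map_pow] at h1
  exact (pow_lt_one_iff_of_nonneg zero_le (by rintro rfl; simp at h1)).1 h1

/-- The Galois group preserves the valuation: by continuity of `σ` and `σ⁻¹` the valuations `w` and
`w ∘ σ` are equivalent, and both have value group `ℤ`. -/
theorem valuation_galois_eq (hK : Function.Surjective (Valued.v : Valuation K ℤᵐ⁰))
    (w : Valuation L ℤᵐ⁰) (hw : Function.Surjective w)
    [(Valued.v : Valuation K ℤᵐ⁰).HasExtension w]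
    (σ : Gal(L/K)) (x : L) : w (σ x) = w x := by
  have key : ∀ (τ : Gal(L/K)) (y : L), w y < 1 → w (τ y) < 1 := fun τ y hy =>
    valuation_algHom_lt_one hK w (τ : L →ₐ[K] L) y hy
  have hequiv : w.IsEquiv (w.comap (σ : L →+* L)) := by
    rw [Valuation.isEquiv_iff_val_lt_one]
    intro y
    refine ⟨key σ y, fun hy => ?_⟩
    simpa using key σ.symm (σ y) hy
  obtain ⟨π, hπ⟩ := hw (exp (-1))
  have hlt_iff : ∀ z : ℤᵐ⁰, z < 1 ↔ z ≤ exp (-1) := by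
    intro z
    rw [← exp_zero, ← WithZero.lt_mul_exp_iff_le exp_ne_zero, ← exp_add]
    simp
  -- `w (σ π) < 1` forces `w (σ π) ≤ exp (-1)`; conversely `π` divides `σ⁻¹ π`,
  -- so `σ π` divides `π`.
  have hσπ : w (σ π) = exp (-1) := by
    refine le_antisymm ((hlt_iff _).1 (key σ π ((hlt_iff _).2 hπ.le))) ?_
    have h1 : w (σ.symm π) ≤ w π := by
      rw [hπ, ← hlt_iff]
      exact key σ.symm π ((hlt_iff _).2 hπ.le)
    have h2 : w (σ (σ.symm π)) ≤ w (σ π) := (hequiv _ _).1 h1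
    rwa [AlgEquiv.apply_symm_apply, hπ] at h2
  rcases eq_or_ne x 0 with rfl | hx
  · simp
  have hx' : w x ≠ 0 := by simpa using hx
  have h1 : w (x * π ^ (log (w x))) = 1 := by
    rw [map_mul, map_zpow₀, hπ, ← exp_zsmul]
    conv_lhs => rw [← exp_log hx']
    rw [← exp_add]
    simp
  have h2 : w (σ (x * π ^ (log (w x)))) = 1 := by
    have := (hequiv.eq_iff (r := x * π ^ (log (w x))) (s := 1)).1 (by rw [h1, map_one])
    simpa using this
  rw [map_mul, map_zpow₀, map_mul, map_zpow₀, hσπ] at h2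
  rw [map_mul, map_zpow₀, hπ, ← h2] at h1
  exact (mul_right_cancel₀ (zpow_ne_zero _ exp_ne_zero) h1).symm
end

/-! ### Arithmetic of the additive valuation -/

section
variable {F : Type*} [Field F] (w : Valuation F ℤᵐ⁰)

theorem ord_eq_iff {x : F} (hx : x ≠ 0) {i : ℤ} : ord w x = i ↔ w x = exp (-i) := by
  have h : w x ≠ 0 := by simpa using hx
  unfold ord
  constructor
  · rintro rfl
    simp [exp_log h]
  · intro h'
    simp [h']

theorem ord_eq_ord_iff {x y : F} (hx : x ≠ 0) (hy : y ≠ 0) : ord w x = ord w y ↔ w x = w y := by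
  rw [ord_eq_iff w hx, ← (ord_eq_iff w hy).1 rfl]

theorem ord_mul {x y : F} (hx : x ≠ 0) (hy : y ≠ 0) : ord w (x * y) = ord w x + ord w y := by
  unfold ord
  rw [map_mul, log_mul (by simpa using hx) (by simpa using hy)]
  ring

theorem ord_zpow (x : F) (n : ℤ) : ord w (x ^ n) = n * ord w x := by
  simp [ord, log_zpow]

theorem ord_pow (x : F) (n : ℕ) : ord w (x ^ n) = n * ord w x := by
  simp [ord, log_pow]

variable {w} in
theorem exists_ord_eq (hw : Function.Surjective w) (i : ℤ) : ∃ x ≠ 0, ord w x = i := by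
  obtain ⟨x, hx⟩ := hw (exp (-i))
  have h0 : x ≠ 0 := by
    rintro rfl
    rw [map_zero] at hx
    exact exp_ne_zero hx.symm
  exact ⟨x, h0, (ord_eq_iff w h0).2 hx⟩

theorem ne_zero_of_ord_eq_one {x : F} (h : ord w x = 1) : x ≠ 0 := by
  rintro rfl
  simp [ord] at h

/-- If the nonzero terms of a sum have pairwise distinct valuations, then the valuation of the sum
is that of one of these terms. Consequently the sum is nonzero. -/
theorem exists_valuation_sum_eq {ι : Type*} (s : Finset ι) (f : ι → F)
    (hinj : ∀ i ∈ s, ∀ j ∈ s, f i ≠ 0 → f j ≠ 0 → w (f i) = w (f j) → i = j)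
    (h : ∃ i ∈ s, f i ≠ 0) : ∃ i ∈ s, f i ≠ 0 ∧ w (∑ j ∈ s, f j) = w (f i) := by
  classical
  obtain ⟨i, hi, hmax⟩ := Finset.exists_max_image s (fun i => w (f i)) ⟨_, h.choose_spec.1⟩
  obtain ⟨k, hk, hk0⟩ := h
  have hi0 : f i ≠ 0 := by
    intro h0
    have := hmax k hk
    simp [h0, hk0] at this
  refine ⟨i, hi, hi0, Valuation.map_sum_eq_of_lt w hi fun j hj => ?_⟩
  rw [Finset.mem_sdiff, Finset.mem_singleton] at hj
  rcases eq_or_ne (f j) 0 with h0 | h0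
  · rw [h0, map_zero]
    exact zero_lt_iff.2 (by simpa using hi0)
  · exact lt_of_le_of_ne (hmax j hj.1) fun he => hj.2 (hinj j hj.1 i hi h0 hi0 he)

end

section
variable {K L : Type*} [Field K] [Field L] [Algebra K L]
  (v : Valuation K ℤᵐ⁰) (w : Valuation L ℤᵐ⁰) [v.HasExtension w]

/-- On `K` the valuation of `L` is `e` times the valuation of `K`, where `e`, the value at a prime
element, is the ramification index. -/
theorem ord_algebraMap {ϖ : K} (hϖ : ord v ϖ = 1) {a : K} (ha : a ≠ 0) :
    ord w (algebraMap K L a) = ord w (algebraMap K L ϖ) * ord v a := by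
  have hϖ0 := ne_zero_of_ord_eq_one v hϖ
  have h : v a = v (ϖ ^ ord v a) := by
    rw [← ord_eq_ord_iff v ha (zpow_ne_zero _ hϖ0), ord_zpow, hϖ, mul_one]
  rw [← Valuation.HasExtension.val_map_eq_iff v w, ← ord_eq_ord_iff w (by simpa using ha)
    ((map_ne_zero _).2 (zpow_ne_zero _ hϖ0)), map_zpow₀, ord_zpow] at h
  rw [h, mul_comm]

theorem ord_algebraMap_pos {ϖ : K} (hϖ : ord v ϖ = 1) : 0 < ord w (algebraMap K L ϖ) := by
  have hϖ0 := ne_zero_of_ord_eq_one v hϖ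
  have h1 : v ϖ < 1 := by
    rw [(ord_eq_iff v hϖ0).1 hϖ]; decide
  rw [← Valuation.HasExtension.val_map_lt_one_iff v w,
    (ord_eq_iff w (by simpa using hϖ0)).1 rfl, ← exp_zero, exp_lt_exp] at h1
  linarith

theorem ord_smul_pow {ϖ : K} (hϖ : ord v ϖ = 1) {π : L} (hπ : ord w π = 1) {a : K} (ha : a ≠ 0)
    (i : ℕ) : ord w (a • π ^ i) = ord w (algebraMap K L ϖ) * ord v a + i := by
  rw [Algebra.smul_def, ord_mul w (by simpa using ha) (pow_ne_zero _ (ne_zero_of_ord_eq_one w hπ)),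
    ord_algebraMap v w hϖ ha, ord_pow, hπ, mul_one]

/-- The valuations of the nonzero terms `a i • π ^ i`, `i < e`, are distinct modulo the
ramification index `e`, so one of them is the valuation of the sum. -/
theorem exists_ord_sum_smul_pow_eq {ϖ : K} (hϖ : ord v ϖ = 1) {π : L} (hπ : ord w π = 1) (e : ℕ)
    (he : ord w (algebraMap K L ϖ) = e) (a : Fin e → K) (ha : a ≠ 0) :
    ∑ i, a i • π ^ (i : ℕ) ≠ 0 ∧ ∃ i, a i ≠ 0 ∧
      ord w (∑ i, a i • π ^ (i : ℕ)) = e * ord v (a i) + i := by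
  have hπ0 := ne_zero_of_ord_eq_one w hπ
  have hne : ∀ i : Fin e, a i • π ^ (i : ℕ) ≠ 0 ↔ a i ≠ 0 := by simp [hπ0]
  obtain ⟨k, hk⟩ := Function.ne_iff.1 ha
  obtain ⟨i, -, hi0, hi⟩ := exists_valuation_sum_eq w Finset.univ
    (fun i : Fin e => a i • π ^ (i : ℕ)) (fun i _ j _ hi hj hij => by
      rw [← ord_eq_ord_iff w hi hj, ord_smul_pow v w hϖ hπ ((hne i).1 hi),
        ord_smul_pow v w hϖ hπ ((hne j).1 hj), he] at hij
      have h1 := congrArg (· % (e : ℤ)) hij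
      simp only [Int.mul_add_emod_self_left] at h1
      rw [Int.emod_eq_of_lt (by positivity) (by exact_mod_cast i.2),
        Int.emod_eq_of_lt (by positivity) (by exact_mod_cast j.2)] at h1
      exact Fin.ext (by exact_mod_cast h1)) ⟨k, Finset.mem_univ _, (hne k).2 hk⟩
  have hsum : ∑ i, a i • π ^ (i : ℕ) ≠ 0 := by
    rw [← w.ne_zero_iff, hi, w.ne_zero_iff]
    exact hi0
  refine ⟨hsum, i, (hne i).1 hi0, ?_⟩
  rw [(ord_eq_ord_iff w hsum hi0).2 hi, ord_smul_pow v w hϖ hπ ((hne i).1 hi0), he]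

theorem linearIndependent_pow_of_ord {ϖ : K} (hϖ : ord v ϖ = 1) {π : L} (hπ : ord w π = 1) (e : ℕ)
    (he : ord w (algebraMap K L ϖ) = e) : LinearIndependent K fun i : Fin e => π ^ (i : ℕ) := by
  rw [Fintype.linearIndependent_iff]
  intro a ha
  by_contra! hne
  exact (exists_ord_sum_smul_pow_eq v w hϖ hπ e he a (Function.ne_iff.2 hne)).1 ha

end

section
variable {K L : Type*} [Field K] [Field L] [Algebra K L] [FiniteDimensional K L]

theorem groupRingOrbit_lt_top_of_trace_eq_zero [IsGalois K L] {ρ : L}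
    (h : Algebra.trace K L ρ = 0) : groupRingOrbit K ρ < ⊤ := by
  have hle : groupRingOrbit K ρ ≤ LinearMap.ker (Algebra.trace K L) := by
    rw [groupRingOrbit, Submodule.span_le]
    rintro _ ⟨σ, rfl⟩
    change Algebra.trace K L (σ ρ) = 0
    rw [Algebra.trace_eq_of_algEquiv, h]
  refine lt_of_le_of_lt hle (lt_top_iff_ne_top.2 fun htop => ?_)
  exact Algebra.trace_ne_zero K L (LinearMap.ker_eq_top.1 htop)

/-- If the conjugates of `ρ` span `L`, they are linearly independent, since there are `[L : K]` of
them. This turns any nontrivial relation among the conjugates into `groupRingOrbit K ρ ≠ ⊤`. -/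
theorem linearIndependent_of_groupRingOrbit_eq_top [IsGalois K L] {ρ : L}
    (h : groupRingOrbit K ρ = ⊤) : LinearIndependent K fun σ : Gal(L/K) => σ ρ := by
  refine linearIndependent_of_top_le_span_of_card_eq_finrank h.ge ?_
  rw [← Nat.card_eq_fintype_card, IsGalois.card_aut_eq_finrank]

theorem generatesNormalBasis_of_groupRingOrbit_eq_top [IsGalois K L] {ρ : L}
    (h : groupRingOrbit K ρ = ⊤) : GeneratesNormalBasis K ρ :=
  ⟨Module.Basis.mk (linearIndependent_of_groupRingOrbit_eq_top h) (le_of_eq h.symm),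
    fun σ => Module.Basis.mk_apply _ _ σ⟩


end

/-! ### Degrees divisible by a prime other than the characteristic -/

theorem valuation_natCast_eq_one {F : Type*} [Field F] (p : ℕ) [Fact p.Prime] [CharP F p]
    {Γ : Type*} [LinearOrderedCommGroupWithZero Γ] (w : Valuation F Γ) {n : ℕ} (hn : ¬ p ∣ n) :
    w n = 1 := by
  have h1 : (n : ZMod p) ^ (p - 1) = 1 :=
    ZMod.pow_card_sub_one_eq_one (by rwa [Ne, ZMod.natCast_eq_zero_iff])
  have h2 := congrArg (fun z => w (ZMod.castHom dvd_rfl F z)) h1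
  simp only [map_pow, map_natCast, map_one] at h2
  exact (pow_eq_one_iff_of_nonneg zero_le
    (Nat.sub_pos_of_lt (Fact.out (p := p.Prime)).one_lt).ne').1 h2

section
variable {K L : Type*} [Field K] [Field L] [Algebra K L] [FiniteDimensional K L]

/-- When the degree has a prime factor `l ≠ p`, no valuation guarantees a normal basis generator.
The elements produced are fixed by some `g` of order `l`, or killed by `∑ k < l, g ^ k`. -/
theorem exists_ord_eq_of_prime_dvd (p : ℕ) [Fact p.Prime] [CharP K p] [IsGalois K L]
    (w : Valuation L ℤᵐ⁰) (hw : Function.Surjective w)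
    (hinv : ∀ (σ : Gal(L/K)) (x : L), w (σ x) = w x) {l : ℕ} (hl : l.Prime) (hlp : l ≠ p)
    (hdvd : l ∣ Module.finrank K L) (i : ℤ) :
    ∃ ρ : L, ρ ≠ 0 ∧ ord w ρ = i ∧ groupRingOrbit K ρ < ⊤ := by
  have : Fact l.Prime := ⟨hl⟩
  have : CharP L p := charP_of_injective_algebraMap (algebraMap K L).injective p
  rw [← IsGalois.card_aut_eq_finrank] at hdvd
  obtain ⟨g, hg⟩ := exists_prime_orderOf_dvd_card' l hdvd
  have hl1 : w (l : L) = 1 := valuation_natCast_eq_one p w fun h =>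
    hlp ((Nat.prime_dvd_prime_iff_eq (Fact.out (p := p.Prime)) hl).1 h).symm
  have hl0 : (l : L) ≠ 0 := by
    rw [← w.ne_zero_iff, hl1]; exact one_ne_zero
  obtain ⟨x, hx0, hx⟩ := exists_ord_eq hw i
  set T : L → L := fun y => ∑ k ∈ Finset.range l, (g ^ k) y with hT
  have hgT : ∀ y, g (T y) = T y := by
    intro y
    -- Applying `g` shifts the summation index, and the difference telescopes to `g ^ l y - y = 0`.
    have h1 : g (T y) = ∑ k ∈ Finset.range l, (g ^ (k + 1)) y := by
      simp [hT, map_sum, pow_succ']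
    rw [h1, ← sub_eq_zero, hT, ← Finset.sum_sub_distrib,
      Finset.sum_range_sub (fun k => (g ^ k) y), ← hg, pow_orderOf_eq_one, pow_zero, sub_self]
  have hwT : w (T x) ≤ w x := w.map_sum_le fun k _ => (hinv _ _).le
  rcases hwT.lt_or_eq with hlt | heq
  · have hdiv : w (T x / l) < w x := by rwa [map_div₀, hl1, div_one]
    have hval : w (x - T x / l) = w x := w.map_sub_eq_of_lt_left hdiv
    have hne : x - T x / l ≠ 0 := by
      rw [← w.ne_zero_iff, hval, w.ne_zero_iff]; exact hx0
    refine ⟨x - T x / l, hne, by rw [← hx, ord_eq_ord_iff w hne hx0, hval], ?_⟩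
    refine lt_top_iff_ne_top.2 fun htop => ?_
    have hli := (linearIndependent_of_groupRingOrbit_eq_top htop).comp
      (fun k : Fin l => g ^ (k : ℕ)) fun a b hab =>
        Fin.ext (pow_injOn_Iio_orderOf (by simp [hg]) (by simp [hg]) hab)
    have hfix : ∀ k : ℕ, (g ^ k) (T x) = T x := by
      intro k
      induction k with
      | zero => simp
      | succ k ih => rw [pow_succ, AlgEquiv.mul_apply, hgT, ih]
    have hsum : ∑ k : Fin l, (1 : K) • (g ^ (k : ℕ)) (x - T x / l) = 0 := by
      rw [Fin.sum_univ_eq_sum_range (fun k => (1 : K) • (g ^ k) (x - T x / l))]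
      simp only [one_smul, map_sub, map_div₀, map_natCast, hfix, Finset.sum_sub_distrib,
        Finset.sum_const, Finset.card_range, nsmul_eq_mul]
      rw [mul_div_cancel₀ _ hl0, sub_self]
    exact one_ne_zero (Fintype.linearIndependent_iff.1 hli (fun _ => 1) hsum ⟨0, hl.pos⟩)
  · have hne : T x ≠ 0 := by
      rw [← w.ne_zero_iff, heq, w.ne_zero_iff]; exact hx0
    refine ⟨T x, hne, by rw [← hx, ord_eq_ord_iff w hne hx0, heq], ?_⟩
    refine lt_top_iff_ne_top.2 fun htop => ?_
    have hg1 : g = 1 := (linearIndependent_of_groupRingOrbit_eq_top htop).injective (by simp [hgT])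
    rw [hg1, orderOf_one] at hg
    exact hl.one_lt.ne hg

end

/-! ### Extensions that are not fully ramified -/

section
variable {K L : Type*} [Field K] [Field L] [Algebra K L]

/-- If the residue of the unit `u` does not lie in the residue field of `K` (hypothesis `hsep`),
every integer is the valuation of a nonzero element of trace zero. -/
theorem exists_trace_eq_zero_of_residue (w : Valuation L ℤᵐ⁰) (hw : Function.Surjective w)
    {u : L} (hu : w u = 1) (hsep : ∀ a : K, 1 ≤ w (u - algebraMap K L a)) (i : ℤ) :
    ∃ ρ : L, ρ ≠ 0 ∧ ord w ρ = i ∧ Algebra.trace K L ρ = 0 := by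
  obtain ⟨y, hy0, hy⟩ := exists_ord_eq hw i
  by_cases ht : Algebra.trace K L y = 0
  · exact ⟨y, hy0, hy, ht⟩
  suffices h : ∃ z : L, w z = w y ∧ Algebra.trace K L z = 0 by
    obtain ⟨z, hz, hz'⟩ := h
    have hz0 : z ≠ 0 := by
      rw [← w.ne_zero_iff, hz, w.ne_zero_iff]; exact hy0
    exact ⟨z, hz0, by rw [← hy, ord_eq_ord_iff w hz0 hy0, hz], hz'⟩
  -- The trace-zero element `(u - b) * y` has valuation `w y * max 1 (w b)`; divide by `b` if
  -- `w b > 1`.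
  set b : K := Algebra.trace K L (u * y) / Algebra.trace K L y with hb
  have htr : Algebra.trace K L ((u - algebraMap K L b) * y) = 0 := by
    rw [sub_mul, map_sub, ← Algebra.smul_def, map_smul, smul_eq_mul, hb, div_mul_cancel₀ _ ht,
      sub_self]
  rcases le_or_gt (w (algebraMap K L b)) 1 with hle | hgt
  · refine ⟨_, ?_, htr⟩
    rw [map_mul, le_antisymm (w.map_sub_le hu.le hle) (hsep b), one_mul]
  · have hb0 : w (algebraMap K L b) ≠ 0 := (zero_lt_one.trans hgt).ne'
    refine ⟨b⁻¹ • ((u - algebraMap K L b) * y), ?_, by rw [map_smul, htr, smul_zero]⟩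
    rw [Algebra.smul_def, map_mul, map_mul, w.map_sub_eq_of_lt_right (by rwa [hu]), map_inv₀,
      map_inv₀, inv_mul_cancel_left₀ hb0]

/-- If every unit of `L` is congruent to an element of `K`, then the leading term of any `x ≠ 0` is
that of a `K`-multiple of some `π ^ j` with `j < e`. -/
theorem exists_improved_approx (v : Valuation K ℤᵐ⁰) (w : Valuation L ℤᵐ⁰) [v.HasExtension w]
    {ϖ : K} (hϖ : ord v ϖ = 1) {π : L} (hπ : ord w π = 1) (e : ℕ)
    (he : ord w (algebraMap K L ϖ) = e)
    (hres : ∀ u : L, w u = 1 → ∃ a : K, w (u - algebraMap K L a) < 1) {x : L} (hx : x ≠ 0) :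
    ∃ s ∈ Submodule.span K (Set.range fun i : Fin e => π ^ (i : ℕ)), w (s - x) < w x := by
  have hϖ0 := ne_zero_of_ord_eq_one v hϖ
  have hπ0 := ne_zero_of_ord_eq_one w hπ
  have he0 : (0 : ℤ) < e := he ▸ ord_algebraMap_pos v w hϖ
  obtain ⟨j, hj⟩ : ∃ j : ℕ, (j : ℤ) = ord w x % e :=
    ⟨_, Int.toNat_of_nonneg (Int.emod_nonneg _ he0.ne')⟩
  have hje : j < e := by exact_mod_cast hj ▸ Int.emod_lt_of_pos (ord w x) he0
  set c : K := ϖ ^ (ord w x / e)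
  have hc0 : c ≠ 0 := zpow_ne_zero _ hϖ0
  set m : L := c • π ^ j with hm
  have hm0 : m ≠ 0 := smul_ne_zero hc0 (pow_ne_zero _ hπ0)
  -- Writing `ord w x = e * q + j` with `0 ≤ j < e`, the element `m = ϖ ^ q • π ^ j` has the same
  -- valuation as `x`.
  have hmx : w m = w x := by
    rw [← ord_eq_ord_iff w hm0 hx, hm, ord_smul_pow v w hϖ hπ hc0, he, ord_zpow, hϖ, hj, mul_one]
    exact Int.mul_ediv_add_emod _ _
  have hwx : w x ≠ 0 := w.ne_zero_iff.2 hx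
  obtain ⟨a, ha⟩ := hres (x / m) (by rw [map_div₀, hmx, div_self hwx])
  refine ⟨a • m, Submodule.smul_mem _ _ (Submodule.smul_mem _ _
    (Submodule.subset_span ⟨⟨j, hje⟩, rfl⟩)), ?_⟩
  have h1 : a • m - x = -((x / m - algebraMap K L a) * m) := by
    rw [sub_mul, div_mul_cancel₀ _ hm0, Algebra.smul_def]; ring
  rw [h1, Valuation.map_neg, map_mul, hmx]
  exact mul_lt_of_lt_one_left (zero_lt_iff.2 hwx) ha

variable [FiniteDimensional K L]

/-- A complete discretely valued field has no extension with ramification index smaller than the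
degree and trivial residue extension: the `K`-span of `π ^ j`, `j < e`, is dense and closed. -/
theorem isFullyRamified_of_residue [Valued K ℤᵐ⁰] [CompleteSpace K]
    (hK : Function.Surjective (Valued.v : Valuation K ℤᵐ⁰))
    (w : Valuation L ℤᵐ⁰) (hw : Function.Surjective w)
    [(Valued.v : Valuation K ℤᵐ⁰).HasExtension w]
    (hres : ∀ u : L, w u = 1 → ∃ a : K, w (u - algebraMap K L a) < 1) :
    IsFullyRamified (Valued.v : Valuation K ℤᵐ⁰) w := by
  intro ϖ hϖ
  obtain ⟨e, he⟩ := Int.eq_ofNat_of_zero_le (ord_algebraMap_pos Valued.v w hϖ).le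
  obtain ⟨π, -, hπ⟩ := exists_ord_eq hw 1
  set S := Submodule.span K (Set.range fun i : Fin e => π ^ (i : ℕ)) with hS
  have happrox : ∀ (x : L) (n : ℕ), ∃ s ∈ S, w (s - x) ≤ w x * exp (-(n : ℤ)) := by
    intro x n
    induction n with
    | zero => exact ⟨0, S.zero_mem, by simp⟩
    | succ n ih =>
      obtain ⟨s, hs, hsx⟩ := ih
      rcases eq_or_ne (x - s) 0 with h0 | h0
      · refine ⟨s, hs, ?_⟩
        rw [w.map_sub_swap, h0, map_zero]
        exact zero_le
      · obtain ⟨t, ht, htx⟩ := exists_improved_approx Valued.v w hϖ hπ e he hres h0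
        refine ⟨s + t, S.add_mem hs ht, ?_⟩
        rw [w.map_sub_swap] at hsx
        have hx0 : w x ≠ 0 := by
          intro h
          rw [h, zero_mul] at hsx
          exact w.ne_zero_iff.2 h0 (le_antisymm hsx zero_le)
        rw [← WithZero.lt_mul_exp_iff_le (mul_ne_zero hx0 exp_ne_zero), mul_assoc, ← exp_add]
        rw [show s + t - x = t - (x - s) by ring]
        convert! htx.trans_le hsx using 3
        push_cast
        ring
  have htop : S = ⊤ := by
    refine (Submodule.eq_top_iff' ).2 fun x => mem_submodule_of_approx hK w S x fun n => ?_
    rcases eq_or_ne x 0 with rfl | hx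
    · exact ⟨0, S.zero_mem, by simp⟩
    have hx' : w x ≠ 0 := w.ne_zero_iff.2 hx
    obtain ⟨k, hk⟩ := exists_exp_neg_natCast_lt (x := exp n / w x) (div_ne_zero exp_ne_zero hx')
    obtain ⟨s, hs, hsx⟩ := happrox x k
    refine ⟨s, hs, hsx.trans_lt ?_⟩
    rwa [mul_comm, ← lt_div_iff₀ (zero_lt_iff.2 hx')]
  have hli := linearIndependent_pow_of_ord Valued.v w hϖ hπ e he
  have hcard := finrank_span_eq_card hli
  rw [← hS, htop, finrank_top, Fintype.card_fin] at hcard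
  rw [he, hcard]

end

/-! ### The trace in fully ramified extensions -/

section
variable {K L : Type*} [Field K] [Field L] [Algebra K L] [FiniteDimensional K L]

/-- Euler's formula for the trace of `x ^ r / f'(x)`, where `f` is the minimal polynomial of `x`. -/
theorem trace_pow_div_aeval_derivative [Algebra.IsSeparable K L] {x : L}
    (hx : Algebra.adjoin K {x} = ⊤) {r : ℕ} (hr : r < Module.finrank K L) :
    Algebra.trace K L (x ^ r / Polynomial.aeval x (Polynomial.derivative (minpoly K x))) =
      if r + 1 = Module.finrank K L then 1 else 0 := by
  have hint : IsIntegral K x := Algebra.IsIntegral.isIntegral x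
  have hdeg : (minpoly K x).natDegree = Module.finrank K L := by
    rw [← IntermediateField.adjoin.finrank hint,
      (IntermediateField.adjoin_eq_top_iff).2 hx, IntermediateField.finrank_top']
  -- The formula is the comparison of coefficients of degree `N - 1` in
  -- `∑ σ, σ (x ^ r / f'(x) • (f / (X - x))) = X ^ r`, where `f / (X - x)` is monic
  -- of degree `N - 1`.
  have hcoeff : (minpolyDiv K x).coeff (Module.finrank K L - 1) = 1 := by
    rw [← hdeg, ← natDegree_minpolyDiv]
    exact minpolyDiv_monic hint
  apply (algebraMap K (AlgebraicClosure K)).injective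
  rw [trace_eq_sum_embeddings (AlgebraicClosure K)]
  have h := congrArg (fun q => Polynomial.coeff q (Module.finrank K L - 1))
    (sum_smul_minpolyDiv_eq_X_pow (K := K) (AlgebraicClosure K) hx hr)
  simp only [Polynomial.finsetSum_coeff, Polynomial.coeff_map, Polynomial.coeff_smul, hcoeff,
    smul_eq_mul, mul_one, Polynomial.coeff_X_pow] at h
  refine h.trans ?_
  have hiff : Module.finrank K L - 1 = r ↔ r + 1 = Module.finrank K L := by omega
  simp [hiff]

/-- In the expansion of `ρ` along `π ^ r / f'(π)`, `r < N`, the term that determines the valuation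
of `ρ` has `r = N - 1`, and its coefficient is the trace of `ρ`. -/
theorem trace_ne_zero_of_ord (v : Valuation K ℤᵐ⁰) (hv : Function.Surjective v)
    (w : Valuation L ℤᵐ⁰) [v.HasExtension w]
    [Algebra.IsSeparable K L] (hram : IsFullyRamified v w) {π : L} (hπ : ord w π = 1) {ρ : L}
    (hρ0 : ρ ≠ 0)
    (hρ : ord w ρ ≡ -ord w (Polynomial.aeval π (Polynomial.derivative (minpoly K π))) - 1
      [ZMOD (Module.finrank K L : ℤ)]) : Algebra.trace K L ρ ≠ 0 := by
  obtain ⟨ϖ, -, hϖ⟩ := exists_ord_eq hv 1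
  have he := hram ϖ hϖ
  set N := Module.finrank K L with hN
  have hNpos : 0 < N := Module.finrank_pos
  set D := Polynomial.aeval π (Polynomial.derivative (minpoly K π)) with hD
  have hD0 : D ≠ 0 :=
    (Algebra.IsSeparable.isSeparable K π).aeval_derivative_ne_zero (minpoly.aeval _ _)
  have hli := linearIndependent_pow_of_ord v w hϖ hπ N he
  have hspan := hli.span_eq_top_of_card_eq_finrank' (by simp [hN])
  have hadj : Algebra.adjoin K {π} = ⊤ := by
    rw [← Algebra.toSubmodule_eq_top, ← top_le_iff, ← hspan, Submodule.span_le]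
    rintro _ ⟨i, rfl⟩
    exact pow_mem (Algebra.self_mem_adjoin_singleton K π) _
  obtain ⟨a, ha⟩ := (Submodule.mem_span_range_iff_exists_fun K).1
    (hspan ▸ Submodule.mem_top : ρ * D ∈ Submodule.span K (Set.range fun i : Fin N => π ^ (i : ℕ)))
  have ha0 : a ≠ 0 := by
    rintro rfl
    simp [hρ0, hD0] at ha
  obtain ⟨-, j, hj0, hj⟩ := exists_ord_sum_smul_pow_eq v w hϖ hπ N he a ha0
  rw [ha, ord_mul w hρ0 hD0] at hj
  have hjN : (j : ℕ) + 1 = N := by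
    have h1 : (N : ℤ) ∣ (j : ℤ) + 1 := by
      obtain ⟨k, hk⟩ := hρ.dvd
      exact ⟨-k - ord v (a j), by linear_combination -hj - hk⟩
    exact le_antisymm j.2 (Nat.le_of_dvd (Nat.succ_pos _) (by exact_mod_cast h1))
  have hρ' : ρ = ∑ i, a i • (π ^ (i : ℕ) / D) := by
    rw [← mul_div_cancel_right₀ ρ hD0, ← ha, Finset.sum_div]
    exact Finset.sum_congr rfl fun i _ => smul_div_assoc _ _ _
  rw [hρ', map_sum]
  simp only [map_smul, smul_eq_mul]
  rw [Finset.sum_eq_single j]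
  · rw [trace_pow_div_aeval_derivative hadj j.2, if_pos hjN, mul_one]
    exact hj0
  · intro i _ hij
    rw [trace_pow_div_aeval_derivative hadj i.2, if_neg, mul_zero]
    intro hi
    exact hij (Fin.ext (by omega))
  · simp

/-- Outside the critical class, a valuation does not guarantee a normal basis generator: trace-zero
elements of valuation `i` exist. -/
theorem exists_ord_eq_of_not_modEq (v : Valuation K ℤᵐ⁰) (hv : Function.Surjective v)
    (w : Valuation L ℤᵐ⁰) (hw : Function.Surjective w) [v.HasExtension w]
    [IsGalois K L] (hram : IsFullyRamified v w) {π : L} (hπ : ord w π = 1) {i : ℤ}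
    (hi : ¬ i ≡ -ord w (Polynomial.aeval π (Polynomial.derivative (minpoly K π))) - 1
      [ZMOD (Module.finrank K L : ℤ)]) :
    ∃ ρ : L, ρ ≠ 0 ∧ ord w ρ = i ∧ groupRingOrbit K ρ < ⊤ := by
  set c := -ord w (Polynomial.aeval π (Polynomial.derivative (minpoly K π))) - 1
  obtain ⟨ϖ, -, hϖ⟩ := exists_ord_eq hv 1
  have he := hram ϖ hϖ
  obtain ⟨x, hx0, hx⟩ := exists_ord_eq hw i
  obtain ⟨y, hy0, hy⟩ := exists_ord_eq hw c
  have hty : Algebra.trace K L y ≠ 0 :=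
    trace_ne_zero_of_ord v hv w hram hπ hy0 (by rw [hy])
  set b := Algebra.trace K L x / Algebra.trace K L y with hb
  have htr : Algebra.trace K L (x - b • y) = 0 := by
    rw [map_sub, map_smul, smul_eq_mul, hb, div_mul_cancel₀ _ hty, sub_self]
  -- Equal valuations are impossible, as `i` is not in the class of `c` modulo the degree. If
  -- `b • y` dominated, `x - b • y` would lie in the class of `c` and so have nonzero trace.
  have hlt : w (b • y) < w x := by
    rcases eq_or_ne b 0 with h0 | h0
    · rw [h0, zero_smul, map_zero]
      exact zero_lt_iff.2 (w.ne_zero_iff.2 hx0)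
    have hby0 : b • y ≠ 0 := smul_ne_zero h0 hy0
    have hby : ord w (b • y) ≡ c [ZMOD (Module.finrank K L : ℤ)] := by
      rw [Algebra.smul_def, ord_mul w (by simpa using h0) hy0, ord_algebraMap v w hϖ h0, he, hy]
      simp [Int.ModEq]
    rcases lt_trichotomy (w (b • y)) (w x) with h | h | h
    · exact h
    · rw [← ord_eq_ord_iff w hby0 hx0, hx] at h
      exact absurd (h ▸ hby) hi
    · have h1 := w.map_sub_eq_of_lt_right h
      have h2 : x - b • y ≠ 0 := by
        rw [← w.ne_zero_iff, h1, w.ne_zero_iff]; exact hby0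
      rw [← (ord_eq_ord_iff w h2 hby0).2 h1] at hby
      exact absurd htr (trace_ne_zero_of_ord v hv w hram hπ h2 hby)
  have h1 := w.map_sub_eq_of_lt_left hlt
  have h2 : x - b • y ≠ 0 := by
    rw [← w.ne_zero_iff, h1, w.ne_zero_iff]; exact hx0
  exact ⟨_, h2, by rw [(ord_eq_ord_iff w h2 hx0).2 h1, hx],
    groupRingOrbit_lt_top_of_trace_eq_zero htr⟩

/-! ### Galois groups that are `p`-groups -/

/-- A nonzero subspace stable under a Galois `p`-group contains a nonzero fixed vector. The orbit of
a nonzero vector generates a finite `p`-torsion group `A`, and the fixed points in `A` are counted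
modulo `p`. -/
theorem exists_ne_zero_mem_fixed (p : ℕ) [Fact p.Prime] [CharP L p] {n : ℕ}
    (hG : Nat.card Gal(L/K) = p ^ n) (W : Submodule K L)
    (hW : ∀ (σ : Gal(L/K)), ∀ y ∈ W, σ y ∈ W) (hne : W ≠ ⊥) :
    ∃ y ∈ W, y ≠ 0 ∧ ∀ σ : Gal(L/K), σ y = y := by
  obtain ⟨y, hy, hy0⟩ := W.ne_bot_iff.1 hne
  set A : AddSubgroup L := AddSubgroup.closure (Set.range fun σ : Gal(L/K) => σ y) with hA
  have hAW : A ≤ W.toAddSubgroup := by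
    rw [hA, AddSubgroup.closure_le]
    rintro _ ⟨σ, rfl⟩
    exact hW σ y hy
  have hAσ : ∀ (σ : Gal(L/K)), ∀ z ∈ A, σ z ∈ A := by
    intro σ z hz
    have : A ≤ A.comap (σ : L →+ L) := by
      rw [hA, AddSubgroup.closure_le]
      rintro _ ⟨τ, rfl⟩
      exact AddSubgroup.subset_closure ⟨σ * τ, rfl⟩
    exact this hz
  have hyA : y ∈ A := AddSubgroup.subset_closure ⟨1, rfl⟩
  have hpA : ∀ z : A, p • z = 0 := fun z => Subtype.ext (by simp)
  have hfin : Finite A := by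
    have : AddGroup.FG A := (AddGroup.fg_iff_addSubgroup_fg A).2 
      ⟨(Set.finite_range fun σ : Gal(L/K) => σ y).toFinset, by simp [hA]⟩
    refine AddCommGroup.finite_of_fg_isAddTorsion A fun z => ?_
    exact isOfFinAddOrder_iff_nsmul_eq_zero.2 ⟨p, (Fact.out (p := p.Prime)).pos, hpA z⟩
  let : MulAction Gal(L/K) A :=
    { smul := fun σ z => ⟨σ z, hAσ σ z z.2⟩
      one_smul := fun z => rfl
      mul_smul := fun σ τ z => rfl }
  have hdvd : p ∣ Nat.card A := by
    have h := addOrderOf_eq_prime (hpA ⟨y, hyA⟩) (by simpa using hy0)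
    rw [← h]
    exact addOrderOf_dvd_natCard _
  obtain ⟨b, hb, hb0⟩ := (IsPGroup.of_card hG).exists_fixed_point_of_prime_dvd_card_of_fixed_point
    A hdvd (a := 0) fun σ => Subtype.ext (map_zero σ)
  exact ⟨b, hAW b.2, fun h => hb0 (Subtype.ext h.symm), fun σ => congrArg Subtype.val (hb σ)⟩

/-- For a `p`-group in characteristic `p`, nonvanishing of the trace characterizes normal basis
generators; this is the sufficiency. -/
theorem groupRingOrbit_eq_top_of_trace_ne_zero (p : ℕ) [Fact p.Prime] [CharP K p] [IsGalois K L]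
    {n : ℕ} (hn : Module.finrank K L = p ^ n) {ρ : L} (h : Algebra.trace K L ρ ≠ 0) :
    groupRingOrbit K ρ = ⊤ := by
  have : CharP L p := charP_of_injective_algebraMap (algebraMap K L).injective p
  by_contra hne
  -- `W` is the orthogonal complement of `K[G] · ρ` under the trace form.
  set W : Submodule K L :=
    ⨅ σ : Gal(L/K), LinearMap.ker (Algebra.trace K L ∘ₗ LinearMap.mulRight K (σ ρ)) with hWdef
  have hmem : ∀ y, y ∈ W ↔ ∀ σ : Gal(L/K), Algebra.trace K L (y * σ ρ) = 0 := by
    simp [hWdef]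
  have hW0 : W ≠ ⊥ := by
    obtain ⟨f, hf0, hf⟩ := Submodule.exists_le_ker_of_lt_top _ (lt_top_iff_ne_top.2 hne)
    obtain ⟨y, rfl⟩ := ((Algebra.traceForm K L).toDual (traceForm_nondegenerate K L)).surjective f
    refine W.ne_bot_iff.2 ⟨y, (hmem y).2 fun σ => ?_, fun h0 => hf0 (by rw [h0, map_zero])⟩
    have := hf (Submodule.subset_span ⟨σ, rfl⟩ : σ ρ ∈ groupRingOrbit K ρ)
    rwa [LinearMap.mem_ker, LinearMap.BilinForm.toDual_def, Algebra.traceForm_apply] at this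
  obtain ⟨y, hy, hy0, hfix⟩ := exists_ne_zero_mem_fixed p
    ((IsGalois.card_aut_eq_finrank K L).trans hn) W (fun σ y hy => (hmem _).2 fun τ => by
      have := (hmem y).1 hy (σ⁻¹ * τ)
      rw [← Algebra.trace_eq_of_algEquiv σ, map_mul] at this
      simpa [← AlgEquiv.mul_apply] using this) hW0
  obtain ⟨c, rfl⟩ := (IsGalois.mem_range_algebraMap_iff_fixed y).2 hfix
  have h1 := (hmem _).1 hy 1
  rw [AlgEquiv.one_apply, ← Algebra.smul_def, map_smul, smul_eq_mul] at h1
  exact (mul_ne_zero (by simpa using hy0) h) h1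

end

end ValuationCriterion

theorem mainTheorem1 (p : ℕ) [Fact p.Prime]
    (K : Type*) [Field K] [CharP K p] [Valued K ℤᵐ⁰] [CompleteSpace K]
    (hK : Function.Surjective (Valued.v : Valuation K ℤᵐ⁰))
    [PerfectField 𝓀[K]]
    (L : Type*) [Field L] [Algebra K L] [FiniteDimensional K L] [IsGalois K L]
    (vL : Valuation L ℤᵐ⁰) (hL : Function.Surjective vL)
    [(Valued.v : Valuation K ℤᵐ⁰).HasExtension vL] :
    -- for fully ramified extensions of `p`-power degree: the criterion, and its tightness
    ((IsFullyRamified (Valued.v : Valuation K ℤᵐ⁰) vL ∧ ∃ n : ℕ, Module.finrank K L = p ^ n) →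
      ∀ π : L, ord vL π = 1 →
        (∀ ρ : L, ρ ≠ 0 →
          ord vL ρ ≡ -ord vL (Polynomial.aeval π (Polynomial.derivative (minpoly K π))) - 1
            [ZMOD (Module.finrank K L : ℤ)] →
          GeneratesNormalBasis K ρ ∧ groupRingOrbit K ρ = ⊤) ∧
        (∀ i : ℤ,
          ¬ i ≡ -ord vL (Polynomial.aeval π (Polynomial.derivative (minpoly K π))) - 1
            [ZMOD (Module.finrank K L : ℤ)] →
          ∃ ρ : L, ρ ≠ 0 ∧ ord vL ρ = i ∧ groupRingOrbit K ρ < ⊤)) ∧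
    -- for all other finite Galois extensions: no integer certifies normal basis generators
    (¬ (IsFullyRamified (Valued.v : Valuation K ℤᵐ⁰) vL ∧
        ∃ n : ℕ, Module.finrank K L = p ^ n) →
      ∀ i : ℤ, ∃ ρ : L, ρ ≠ 0 ∧ ord vL ρ = i ∧ groupRingOrbit K ρ < ⊤) := by
  refine ⟨fun ⟨hram, n, hn⟩ π hπ => ⟨fun ρ hρ0 hρ => ?_, fun i hi =>
    exists_ord_eq_of_not_modEq Valued.v hK vL hL hram hπ hi⟩, fun h i => ?_⟩
  · have htop := groupRingOrbit_eq_top_of_trace_ne_zero p hn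
      (trace_ne_zero_of_ord Valued.v hK vL hram hπ hρ0 hρ)
    exact ⟨generatesNormalBasis_of_groupRingOrbit_eq_top htop, htop⟩
  · by_cases hp : ∃ n : ℕ, Module.finrank K L = p ^ n
    · have hram : ¬ IsFullyRamified (Valued.v : Valuation K ℤᵐ⁰) vL := fun hr => h ⟨hr, hp⟩
      obtain ⟨u, hu, hsep⟩ : ∃ u : L, vL u = 1 ∧ ∀ a : K, 1 ≤ vL (u - algebraMap K L a) := by
        by_contra! hres
        exact hram (isFullyRamified_of_residue hK vL hL hres)
      obtain ⟨ρ, hρ0, hρ, htr⟩ := exists_trace_eq_zero_of_residue vL hL hu hsep i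
      exact ⟨ρ, hρ0, hρ, groupRingOrbit_lt_top_of_trace_eq_zero htr⟩
    · obtain ⟨l, hl, hdvd, hlp⟩ : ∃ l : ℕ, l.Prime ∧ l ∣ Module.finrank K L ∧ l ≠ p := by
        by_contra! hall
        exact hp ⟨_, Nat.eq_prime_pow_of_unique_prime_dvd Module.finrank_pos.ne'
          fun {d} hd hdvd => hall d hd hdvd⟩
      exact exists_ord_eq_of_prime_dvd p vL hL (valuation_galois_eq hK vL hL) hl hlp hdvd i
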